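/- Theorem 1.3 (Bergman's centralizer theorem). Let $k$ be a field of positive characteristic, let $s\ge 1$, and let $A=k\langle x_1,\dots,x_s\rangle$ be the free associative (unital) $k$-algebra on $x_1,\dots,x_s$. Then: (1) for every $f\in A\setminus k$, the centralizer $C(f)=\{a\in A : af=fa\}$ is isomorphic, as a $k$-algebra, to the polynomial ring $k[z]$ in one variable; (2) every maximal commutative $k$-subalgebra of $A$ (a commutative $k$-subalgebra not properly contained in another commutative $k$-subalgebra) is isomorphic, as a $k$-algebra, to $k[z]$. -/

import Mathlib

open scoped Polynomial

/-!
The free algebra is the algebra `A` of the free monoid `W` on `s` letters. Three facts about a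
non-scalar `f : A` give the theorem; none of them depends on the characteristic of `k`.

*The centralizer embeds in `k[X]`* (`exists_injective_algHom`). Words act on `ℚ` by increasing
contractions, letter `i` by `x ↦ (x + i) / (s + 1)`, so every nonempty word has a fixed point. Let
`ξ` be the largest fixed point of a nonempty word of `f`. Elements whose words all map `ξ` to a
point `≤ ξ` form a subalgebra `stab k ξ`, and keeping only the words that fix `ξ`, each recorded by
its length, is an algebra homomorphism from it to `k[X]`. An element commuting with `f` lies in
`stab k ξ`, and vanishes if none of its words fixes `ξ` (`eq_zero_of_commute`): otherwise a leading
term of `f * b` is missing from `b * f`.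

*The image `R` of this embedding is integrally closed* (`mem_of_mul_mem`,
`isIntegrallyClosed_of_forall_mem`). Let `u : k[X]` be a quotient of elements of `R`. Since `k[X]`
is integral over `R`, some nonzero `D ∈ R` has `D * u ^ i ∈ R` for all `i`, and some polynomial `e`
has `u ^ i * e(u) ∈ R` for all `i`. Write `a`, `d`, `E` for the elements of `A` that correspond to
`D * u`, `D`, `D * e(u)`. They commute, so the Euclidean algorithm on leading words
(`exists_common_divisor`), over the domain `k[t]`, provides a common left divisor `p` of `a - t d`
and `E` of the form `(a - t d) α + E β` up to factors in `k[t]`. As `p` divides a multiple of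
the constant `E`, a Gauss lemma (`exists_const_of_mul_eq`) makes `p` constant, and then `p`
divides both `a` and `d` on the left. Now multiply by `σ = D (e(t) - e(u)) / (t - u)`: both
`σ (a - t d)` and `σ E` lie in `D ^ 2 R[t]`, so the leading coefficient, a scalar times `D p`,
lies in `D ^ 2 A`. Hence `p`, and with it `a`, lies in `D A` (`exists_eq_mul_of_dividedDiff`); the
quotient commutes with `f` and is sent to `u`.

*An integrally closed `R ⊆ k[X]` over which `X` is integral is a polynomial ring*
(`nonempty_equiv_of_isIntegrallyClosed`). This is Lüroth's argument: a nonconstant coefficient `c`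
of the minimal polynomial `m` of `X` over `R` satisfies `m ∣ c(T) - c`, comparing degrees in `X`
shows that `m` has degree `deg c`, and division by `c` then gives `R = k[c]`.

The second part of the theorem follows from the first: a maximal commutative subalgebra contains
some non-scalar `f`, hence is contained in the centralizer of `f`, which is commutative.
-/

namespace BergmanCentralizer

/-! ### The action of words on the rationals -/

/-- Words in the letters `0, …, s - 1`. -/
abbrev Word (s : ℕ) := FreeMonoid (Fin s)

section Action
variable {s : ℕ}

/-- The action of words on `ℚ` for which the letter `i` is the contraction
`x ↦ (x + i) / (s + 1)`. On `[0, 1)` it prepends the digit `i` in base `s + 1`. -/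
def act (w : Word s) (x : ℚ) : ℚ :=
  w.toList.foldr (fun i y => (y + (i : ℕ)) / (s + 1)) x

@[simp] lemma act_one (x : ℚ) : act (1 : Word s) x = x := rfl

lemma act_mul (u v : Word s) (x : ℚ) : act (u * v) x = act u (act v x) := by
  simp [act, FreeMonoid.toList_mul]

lemma act_of_mul (i : Fin s) (v : Word s) (x : ℚ) :
    act (FreeMonoid.of i * v) x = (act v x + (i : ℕ)) / (s + 1) := by
  simp [act, FreeMonoid.toList_mul]

/-- The ratio of the affine map `act w` depends on the length of `w` only. -/
lemma act_sub_act (w : Word s) (x y : ℚ) :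
    act w x - act w y = (x - y) / (s + 1) ^ w.length := by
  induction w using FreeMonoid.inductionOn' with
  | one => simp
  | of_mul i w ih =>
    rw [act_of_mul, act_of_mul, FreeMonoid.length_mul, FreeMonoid.length_of, pow_add, pow_one,
      ← sub_div, add_sub_add_right_eq_sub, ih, div_div, mul_comm]

lemma act_strictMono (w : Word s) : StrictMono (act w) := fun x y h => by
  have h1 := act_sub_act w y x
  have : 0 < (y - x) / ((s : ℚ) + 1) ^ w.length := div_pos (sub_pos.2 h) (by positivity)
  linarith

lemma act_zero_nonneg (w : Word s) : 0 ≤ act w 0 := by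
  induction w using FreeMonoid.inductionOn' with
  | one => simp
  | of_mul i w ih => rw [act_of_mul]; positivity

lemma act_zero_lt_one (w : Word s) : act w 0 < 1 := by
  induction w using FreeMonoid.inductionOn' with
  | one => simp
  | of_mul i w ih =>
    rw [act_of_mul, div_lt_one (by positivity)]
    have : ((i : ℕ) : ℚ) ≤ s := by exact_mod_cast i.2.le
    linarith

lemma eq_of_act_zero_eq {u v : Word s} (hl : u.length = v.length) (h : act u 0 = act v 0) :
    u = v := by
  induction u using FreeMonoid.inductionOn' generalizing v with
  | one => exact (FreeMonoid.length_eq_zero.1 (by simpa using hl.symm)).symm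
  | of_mul i u ih =>
    induction v using FreeMonoid.inductionOn' with
    | one => simp [FreeMonoid.length_mul] at hl
    | of_mul j v _ =>
      rw [act_of_mul, act_of_mul, div_left_inj' (by positivity)] at h
      have h1 := act_zero_nonneg u
      have h2 := act_zero_nonneg v
      have h3 := act_zero_lt_one u
      have h4 := act_zero_lt_one v
      have hij : (i : ℕ) = (j : ℕ) := by
        have a1 : ((i : ℕ) : ℚ) < (j : ℕ) + 1 := by linarith
        have a2 : ((j : ℕ) : ℚ) < (i : ℕ) + 1 := by linarith
        have a1' : (i : ℕ) < (j : ℕ) + 1 := by exact_mod_cast a1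
        have a2' : (j : ℕ) < (i : ℕ) + 1 := by exact_mod_cast a2
        omega
      have huv : act u 0 = act v 0 := by rw [hij] at h; linarith
      rw [Fin.ext hij, ih (by simpa [FreeMonoid.length_mul] using hl) huv]

/-- A word is determined by its length and its value at a single point. -/
lemma eq_of_act_eq {u v : Word s} (hl : u.length = v.length) {x : ℚ} (h : act u x = act v x) :
    u = v := by
  refine eq_of_act_zero_eq hl ?_
  have h1 := act_sub_act u x 0
  have h2 := act_sub_act v x 0
  rw [hl] at h1
  linarith

/-- A nonempty word exists only for `0 < s`, which makes the action strictly contracting. -/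
lemma one_lt_pow_length {w : Word s} (hw : w ≠ 1) : (1 : ℚ) < (s + 1) ^ w.length := by
  have hl : w.length ≠ 0 := fun h => hw (FreeMonoid.length_eq_zero.1 h)
  have hs : 0 < s := by
    rcases Nat.eq_zero_or_pos s with rfl | h
    · exact absurd (Subsingleton.elim w 1) hw
    · exact h
  have : (0 : ℚ) < s := by exact_mod_cast hs
  exact one_lt_pow₀ (by linarith) hl

/-- The fixed point of the affine contraction `act w`, for `w ≠ 1`. For `w = 1` the denominator
vanishes and the value is junk. -/
def fixedPt (w : Word s) : ℚ := act w 0 / (1 - 1 / (s + 1) ^ w.length)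

lemma act_le_self_iff {w : Word s} (hw : w ≠ 1) {x : ℚ} : act w x ≤ x ↔ fixedPt w ≤ x := by
  have h := one_lt_pow_length hw
  have h1 : (0 : ℚ) < 1 - 1 / (s + 1) ^ w.length := by
    rw [sub_pos, div_lt_one (by linarith)]; exact h
  rw [fixedPt, div_le_iff₀ h1]
  have := act_sub_act w x 0
  have h2 : x * (1 - 1 / (s + 1) ^ w.length) = x - (x - 0) / ((s : ℚ) + 1) ^ w.length := by ring
  rw [h2, ← this]
  constructor <;> intro h <;> linarith

lemma act_fixedPt {w : Word s} (hw : w ≠ 1) : act w (fixedPt w) = fixedPt w := by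
  have h := one_lt_pow_length hw
  have h1 : (1 : ℚ) - 1 / (s + 1) ^ w.length ≠ 0 := by
    rw [sub_ne_zero]; intro h2; rw [eq_comm, div_eq_one_iff_eq (by positivity)] at h2; linarith
  have h3 := act_sub_act w (fixedPt w) 0
  have h4 : fixedPt w * (1 - 1 / (s + 1) ^ w.length) = act w 0 := by
    rw [fixedPt, div_mul_cancel₀ _ h1]
  have h5 : fixedPt w * (1 - 1 / (s + 1) ^ w.length)
    = fixedPt w - (fixedPt w - 0) / ((s : ℚ) + 1) ^ w.length := by ring
  linarith

end Action

section Symbol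
variable {k : Type*} [Field k] {s : ℕ}

/-- The subalgebra of the elements all of whose words move `ξ` weakly to the left. -/
def stab (k : Type*) [Field k] {s : ℕ} (ξ : ℚ) : Subalgebra k (MonoidAlgebra k (Word s)) where
  carrier := {a | ∀ w, a.coeff w ≠ 0 → act w ξ ≤ ξ}
  mul_mem' {a b} ha hb w hw := by
    classical
    have := MonoidAlgebra.support_coeff_mul_subset (x := a) (y := b) (Finsupp.mem_support_iff.2 hw)
    obtain ⟨u, hu, v, hv, rfl⟩ := Finset.mem_mul.1 this
    rw [act_mul]
    exact ((act_strictMono u).monotone (hb v (Finsupp.mem_support_iff.1 hv))).trans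
      (ha u (Finsupp.mem_support_iff.1 hu))
  add_mem' {a b} ha hb w hw := by
    by_cases h : a.coeff w = 0
    · exact hb w (by simpa [h] using hw)
    · exact ha w h
  algebraMap_mem' r w hw := by
    have : w = 1 := by
      by_contra h
      exact hw (by simp [MonoidAlgebra.coe_algebraMap, Ne.symm h])
    simp [this]

/-- The part of `a` supported on the words fixing `ξ`, each such word being replaced by
`X ^ length`. -/
noncomputable def symbolLin (ξ : ℚ) : MonoidAlgebra k (Word s) →ₗ[k] k[X] where
  toFun a := a.coeff.sum fun w c => if act w ξ = ξ then Polynomial.monomial w.length c else 0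
  map_add' a b := by
    rw [MonoidAlgebra.coeff_add]
    exact Finsupp.sum_add_index' (by simp) (by intros; split_ifs <;> simp)
  map_smul' r a := by
    rw [MonoidAlgebra.coeff_smul, Finsupp.sum_smul_index (by simp), RingHom.id_apply,
      Finsupp.smul_sum]
    refine Finsupp.sum_congr fun w _ => ?_
    split_ifs <;> simp [Polynomial.smul_monomial]

lemma symbolLin_single (ξ : ℚ) (w : Word s) (c : k) :
    symbolLin ξ (MonoidAlgebra.single w c) =
      if act w ξ = ξ then Polynomial.monomial w.length c else 0 := by
  simp [symbolLin]

lemma eq_sum_single (a : MonoidAlgebra k (Word s)) :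
    a = ∑ w ∈ a.coeff.support, MonoidAlgebra.single w (a.coeff w) :=
  (MonoidAlgebra.sum_coeff_single a).symm

/-- On `stab k ξ` the symbol is multiplicative: a product `u * v` of words moving `ξ` weakly to the
left fixes `ξ` only if `u` and `v` do. -/
lemma symbolLin_mul {ξ : ℚ} {a b : MonoidAlgebra k (Word s)} (ha : a ∈ stab k ξ)
    (hb : b ∈ stab k ξ) : symbolLin ξ (a * b) = symbolLin ξ a * symbolLin ξ b := by
  conv_lhs => rw [eq_sum_single a, eq_sum_single b]
  conv_rhs => rw [eq_sum_single a, eq_sum_single b]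
  rw [Finset.sum_mul_sum, map_sum, map_sum, map_sum, Finset.sum_mul_sum]
  refine Finset.sum_congr rfl fun u hu => ?_
  rw [map_sum]
  refine Finset.sum_congr rfl fun v hv => ?_
  rw [MonoidAlgebra.single_mul_single, symbolLin_single, symbolLin_single, symbolLin_single,
    act_mul]
  have hu' := ha u (Finsupp.mem_support_iff.1 hu)
  have hv' := hb v (Finsupp.mem_support_iff.1 hv)
  by_cases h : act v ξ = ξ
  · rw [h]
    by_cases h2 : act u ξ = ξ
    · simp [h2, FreeMonoid.length_mul, Polynomial.monomial_mul_monomial]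
    · simp [h2]
  · have : act u (act v ξ) < ξ := lt_of_lt_of_le (act_strictMono u (lt_of_le_of_ne hv' h)) hu'
    simp [h, this.ne]

/-- `symbolLin` as an algebra homomorphism on `stab k ξ`. -/
noncomputable def symbol (k : Type*) [Field k] {s : ℕ} (ξ : ℚ) :
    stab k (s := s) ξ →ₐ[k] k[X] :=
  AlgHom.ofLinearMap ((symbolLin ξ).comp (stab k ξ).val.toLinearMap)
    (by simp [MonoidAlgebra.one_def, symbolLin_single])
    (fun a b => symbolLin_mul a.2 b.2)

/-- Words fixing `ξ` are determined by their lengths, so the symbol loses no coefficient. -/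
lemma symbolLin_coeff {ξ : ℚ} (a : MonoidAlgebra k (Word s)) {w : Word s} (hw : act w ξ = ξ) :
    (symbolLin ξ a).coeff w.length = a.coeff w := by
  classical
  induction a using MonoidAlgebra.induction_linear with
  | zero => simp
  | add a b ha hb => simp [ha, hb]
  | single u c =>
    rw [symbolLin_single, MonoidAlgebra.coeff_single, Finsupp.single_apply]
    by_cases h : act u ξ = ξ
    · rw [if_pos h, Polynomial.coeff_monomial]
      by_cases h2 : u = w
      · simp [h2]
      · rw [if_neg h2, if_neg]
        exact fun h3 => h2 (eq_of_act_eq h3 (h.trans hw.symm))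
    · rw [if_neg h, if_neg (by rintro rfl; exact h hw), Polynomial.coeff_zero]

/-- Let `a ∈ stab k ξ` contain a nonempty word fixing `ξ`. An element `b` commuting with `a` whose
words all move `ξ` strictly to the left vanishes: by contraction some word of `a * b` moves `ξ`
farther to the right than every word of `b * a` does. -/
theorem eq_zero_of_commute {ξ : ℚ} {a b : MonoidAlgebra k (Word s)} (hab : a * b = b * a)
    (ha : a ∈ stab k ξ) (hb : ∀ w, b.coeff w ≠ 0 → act w ξ < ξ)
    {n₀ : Word s} (hn₀ : n₀ ≠ 1) (hn₀a : a.coeff n₀ ≠ 0) (hn₀ξ : act n₀ ξ = ξ) : b = 0 := by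
  classical
  by_contra hb0
  have hbne : b.coeff.support.Nonempty := by
    rw [Finsupp.support_nonempty_iff]; exact fun h => hb0 (MonoidAlgebra.coeff_eq_zero.1 h)
  obtain ⟨m, hm, hmax⟩ := Finset.exists_max_image b.coeff.support (fun w => act w ξ) hbne
  set μ := act m ξ with hμ
  have hμξ : μ < ξ := hb m (Finsupp.mem_support_iff.1 hm)
  obtain ⟨n, hn, hnmax⟩ := Finset.exists_max_image a.coeff.support (fun w => act w μ)
    ⟨n₀, Finsupp.mem_support_iff.2 hn₀a⟩
  -- `M` is the largest value at `ξ` of a word of `a * b`, and it exceeds `μ`, which bounds the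
  -- values of the words of `b * a`.
  set M := act n μ with hM
  have hμM : μ < M := by
    refine lt_of_lt_of_le ?_ (hnmax n₀ (Finsupp.mem_support_iff.2 hn₀a))
    have h1 := act_sub_act n₀ ξ μ
    have h2 : (ξ - μ) / ((s : ℚ) + 1) ^ n₀.length < ξ - μ :=
      div_lt_self (sub_pos.2 hμξ) (one_lt_pow_length hn₀)
    rw [hn₀ξ] at h1
    linarith
  obtain ⟨m₁, hm₁, hm₁max⟩ := Finset.exists_max_image
    (b.coeff.support.filter fun w => act w ξ = μ) (fun w => w.length)
    ⟨m, Finset.mem_filter.2 ⟨hm, rfl⟩⟩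
  obtain ⟨n₁, hn₁, hn₁max⟩ := Finset.exists_max_image
    (a.coeff.support.filter fun w => act w μ = M) (fun w => w.length)
    ⟨n, Finset.mem_filter.2 ⟨hn, rfl⟩⟩
  rw [Finset.mem_filter] at hm₁ hn₁
  -- Words of maximal length among those reaching `M` cannot be split in another way, so the
  -- coefficient of `n₁ * m₁` in `a * b` does not cancel.
  have hU : UniqueMul a.coeff.support b.coeff.support n₁ m₁ := by
    intro u v hu hv huv
    have hkey : act u (act v ξ) = M := by
      rw [← act_mul, huv, act_mul, hm₁.2, hn₁.2]
    have hv1 : act v ξ = μ := by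
      refine le_antisymm (hmax v hv) (not_lt.1 fun h => ?_)
      have := act_strictMono u h
      have := hnmax u hu
      linarith
    have hu1 : act u μ = M := by rw [← hv1, hkey]
    have l1 := hm₁max v (Finset.mem_filter.2 ⟨hv, hv1⟩)
    have l2 := hn₁max u (Finset.mem_filter.2 ⟨hu, hu1⟩)
    have l3 := congrArg FreeMonoid.length huv
    rw [FreeMonoid.length_mul, FreeMonoid.length_mul] at l3
    exact ⟨eq_of_act_eq (by omega) (hu1.trans hn₁.2.symm),
      eq_of_act_eq (by omega) (hv1.trans hm₁.2.symm)⟩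
  have h1 := MonoidAlgebra.coeff_mul_mul_of_uniqueMul hU
  have h2 : (b * a).coeff (n₁ * m₁) ≠ 0 := by
    rw [← hab, h1]
    exact mul_ne_zero (Finsupp.mem_support_iff.1 hn₁.1) (Finsupp.mem_support_iff.1 hm₁.1)
  have := MonoidAlgebra.support_coeff_mul_subset (x := b) (y := a) (Finsupp.mem_support_iff.2 h2)
  obtain ⟨u, hu, v, hv, huv⟩ := Finset.mem_mul.1 this
  have hk : act u (act v ξ) = M := by rw [← act_mul, huv, act_mul, hm₁.2, hn₁.2]
  have h3 : act u (act v ξ) ≤ act u ξ :=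
    (act_strictMono u).monotone (ha v (Finsupp.mem_support_iff.1 hv))
  have h4 := hmax u hu
  linarith

/-- Among the nonempty words occurring in `a`, one with the largest fixed point. -/
lemma exists_fixed_word {a : MonoidAlgebra k (Word s)} (h : ∃ w, w ≠ 1 ∧ a.coeff w ≠ 0) :
    ∃ n, n ≠ 1 ∧ a.coeff n ≠ 0 ∧ act n (fixedPt n) = fixedPt n ∧
      ∀ w, w ≠ 1 → a.coeff w ≠ 0 → fixedPt w ≤ fixedPt n := by
  classical
  obtain ⟨w, hw, hwa⟩ := h
  obtain ⟨n, hn, hmax⟩ := Finset.exists_max_image (a.coeff.support.filter fun w => w ≠ 1) fixedPt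
    ⟨w, Finset.mem_filter.2 ⟨Finsupp.mem_support_iff.2 hwa, hw⟩⟩
  rw [Finset.mem_filter] at hn
  exact ⟨n, hn.2, Finsupp.mem_support_iff.1 hn.1, act_fixedPt hn.2, fun v hv hva =>
    hmax v (Finset.mem_filter.2 ⟨Finsupp.mem_support_iff.2 hva, hv⟩)⟩

lemma mem_stab_of_fixedPt_le {ξ : ℚ} {a : MonoidAlgebra k (Word s)}
    (h : ∀ w, w ≠ 1 → a.coeff w ≠ 0 → fixedPt w ≤ ξ) : a ∈ stab k ξ := by
  intro w hw
  by_cases h1 : w = 1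
  · simp [h1]
  · exact (act_le_self_iff h1).2 (h w h1 hw)

lemma exists_ne_one_of_notMem_range {a : MonoidAlgebra k (Word s)}
    (ha : a ∉ Set.range (algebraMap k (MonoidAlgebra k (Word s)))) :
    ∃ w, w ≠ 1 ∧ a.coeff w ≠ 0 := by
  by_contra! h
  refine ha ⟨a.coeff 1, ?_⟩
  ext w
  by_cases h1 : w = 1
  · simp [h1, MonoidAlgebra.coe_algebraMap]
  · rw [h w h1]
    simp [MonoidAlgebra.coe_algebraMap, Ne.symm h1]

/-- The fixed points of the words of `c` do not exceed the largest one of `a`: otherwise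
`eq_zero_of_commute`, with the roles of `a` and `c` exchanged, would make `a` a scalar. -/
lemma mem_stab_of_commute {a c : MonoidAlgebra k (Word s)} {n : Word s} (hn : n ≠ 1)
    (hna : a.coeff n ≠ 0) (hmax : ∀ w, w ≠ 1 → a.coeff w ≠ 0 → fixedPt w ≤ fixedPt n)
    (hac : a * c = c * a) : c ∈ stab k (fixedPt n) := by
  by_contra hc
  have hex : ∃ w, w ≠ 1 ∧ c.coeff w ≠ 0 := by
    refine exists_ne_one_of_notMem_range ?_
    rintro ⟨r, rfl⟩
    exact hc (algebraMap_mem _ r)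
  obtain ⟨m, hm, hmc, hmfix, hmmax⟩ := exists_fixed_word hex
  have hlt : fixedPt n < fixedPt m := by
    by_contra! hle
    exact hc (mem_stab_of_fixedPt_le fun w hw hwc => (hmmax w hw hwc).trans hle)
  have hcm : c ∈ stab k (fixedPt m) := mem_stab_of_fixedPt_le hmmax
  -- The constant term of `a` fixes every point and has to be removed first.
  have h0 : a - algebraMap k _ (a.coeff 1) = 0 := by
    refine eq_zero_of_commute (a := c) (ξ := fixedPt m) ?_ hcm ?_ hm hmc hmfix
    · rw [mul_sub, sub_mul, hac, Algebra.commutes]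
    · intro w hw
      have hw1 : w ≠ 1 := by
        rintro rfl
        exact hw (by simp [MonoidAlgebra.coe_algebraMap])
      have hwa : a.coeff w ≠ 0 := by
        simpa [MonoidAlgebra.coe_algebraMap, Ne.symm hw1] using hw
      have h2 : fixedPt w < fixedPt m := (hmax w hw1 hwa).trans_lt hlt
      by_contra! h3
      rcases h3.eq_or_lt with h4 | h4
      · have h5 := act_sub_act w (fixedPt m) (fixedPt w)
        rw [act_fixedPt hw1, ← h4] at h5
        have := div_lt_self (sub_pos.2 h2) (one_lt_pow_length hw1)
        linarith
      · exact absurd ((act_le_self_iff hw1).2 h2.le) (not_le.2 h4)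
  apply hna
  rw [sub_eq_zero] at h0
  rw [h0]
  simp [MonoidAlgebra.coe_algebraMap, Ne.symm hn]

/-- The centralizer of a non-scalar element embeds in `k[X]`; in particular it is commutative. -/
theorem exists_injective_algHom {a : MonoidAlgebra k (Word s)}
    (ha : a ∉ Set.range (algebraMap k (MonoidAlgebra k (Word s)))) :
    ∃ φ : Subalgebra.centralizer k ({a} : Set (MonoidAlgebra k (Word s))) →ₐ[k] k[X],
      Function.Injective φ := by
  obtain ⟨n, hn, hna, hfix, hmax⟩ := exists_fixed_word (exists_ne_one_of_notMem_range ha)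
  have hcomm : ∀ c ∈ Subalgebra.centralizer k ({a} : Set (MonoidAlgebra k (Word s))),
      a * c = c * a := fun c hc => Subalgebra.mem_centralizer_iff k |>.1 hc a rfl
  have hle : Subalgebra.centralizer k ({a} : Set (MonoidAlgebra k (Word s))) ≤
      stab k (fixedPt n) := fun c hc => mem_stab_of_commute hn hna hmax (hcomm c hc)
  refine ⟨(symbol k (fixedPt n)).comp (Subalgebra.inclusion hle), ?_⟩
  rw [injective_iff_map_eq_zero]
  rintro ⟨c, hc⟩ h
  have h' : symbolLin (fixedPt n) c = 0 := h
  refine Subtype.ext ?_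
  refine eq_zero_of_commute (hcomm c hc) (mem_stab_of_fixedPt_le hmax) ?_ hn hna hfix
  intro w hw
  refine lt_of_le_of_ne (hle hc w hw) fun h1 => hw ?_
  rw [← symbolLin_coeff c h1, h', Polynomial.coeff_zero]

end Symbol

/-! ### Leading words and common left divisors -/

section Code
variable {s : ℕ}

/-- The rank of a word in a total order compatible with multiplication: the letter `i` is read as
the digit `i + 1` in base `s + 2`, the first letter being the least significant. Zero does not
occur as a digit, which makes `code` injective and monotone in the length. -/
def code (w : Word s) : ℕ := Nat.ofDigits (s + 2) (w.toList.map fun i : Fin s => i.val + 1)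

lemma digits_code (w : Word s) :
    Nat.digits (s + 2) (code w) = w.toList.map fun i : Fin s => i.val + 1 := by
  refine Nat.digits_ofDigits _ (by omega) _ (fun l hl => ?_) (fun h => ?_)
  · obtain ⟨i, -, rfl⟩ := List.mem_map.1 hl
    omega
  · have := List.getLast_mem h
    obtain ⟨i, -, hi⟩ := List.mem_map.1 this
    omega

lemma code_injective : Function.Injective (code (s := s)) := by
  intro u v h
  have h1 := digits_code u
  rw [h, digits_code v] at h1
  refine FreeMonoid.toList.injective ((List.map_injective_iff.2 fun i j hij => ?_) h1.symm)
  exact Fin.ext (by simpa using hij)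

lemma length_le_of_code_le {u v : Word s} (h : code u ≤ code v) : u.length ≤ v.length := by
  have := Nat.le_length_digits_le (s + 2) _ _ h
  rw [digits_code, digits_code, List.length_map, List.length_map] at this
  exact this

lemma code_mul (u v : Word s) : code (u * v) = code u + (s + 2) ^ u.length * code v := by
  simp [code, FreeMonoid.toList_mul, Nat.ofDigits_append, FreeMonoid.length]

lemma code_mul_lt_mul_left {u v v' : Word s} (h : code v < code v') :
    code (u * v) < code (u * v') := by
  rw [code_mul, code_mul]
  gcongr

lemma code_mul_lt_mul_right {u u' v : Word s} (h : code u < code u') :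
    code (u * v) < code (u' * v) := by
  rw [code_mul, code_mul]
  have := length_le_of_code_le h.le
  have h2 : (s + 2) ^ u.length * code v ≤ (s + 2) ^ u'.length * code v := by
    gcongr; omega
  omega

lemma code_mul_le_mul {u u' v v' : Word s} (h : code u ≤ code u') (h' : code v ≤ code v') :
    code (u * v) ≤ code (u' * v') := by
  have h1 : code (u * v) ≤ code (u' * v) := by
    rcases h.eq_or_lt with h | h
    · rw [code_injective h]
    · exact (code_mul_lt_mul_right h).le
  refine h1.trans ?_
  rcases h'.eq_or_lt with h | h
  · rw [code_injective h]
  · exact (code_mul_lt_mul_left h).le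

end Code

section Lead
variable {O : Type*} [CommRing O] {s : ℕ}

/-- `w` is the word of largest `code` among those occurring in `a`. -/
def IsLead (a : MonoidAlgebra O (Word s)) (w : Word s) : Prop :=
  a.coeff w ≠ 0 ∧ ∀ v, a.coeff v ≠ 0 → code v ≤ code w

lemma exists_isLead {a : MonoidAlgebra O (Word s)} (ha : a ≠ 0) : ∃ w, IsLead a w := by
  have hne : a.coeff.support.Nonempty := by
    rw [Finsupp.support_nonempty_iff]; exact fun h => ha (MonoidAlgebra.coeff_eq_zero.1 h)
  obtain ⟨m, hm, hmax⟩ := Finset.exists_max_image a.coeff.support code hne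
  exact ⟨m, Finsupp.mem_support_iff.1 hm, fun v hv => hmax v (Finsupp.mem_support_iff.2 hv)⟩

lemma IsLead.unique {a : MonoidAlgebra O (Word s)} {u v : Word s} (hu : IsLead a u)
    (hv : IsLead a v) : u = v :=
  code_injective (le_antisymm (hv.2 u hu.1) (hu.2 v hv.1))

lemma IsLead.mul [NoZeroDivisors O] {a b : MonoidAlgebra O (Word s)} {u v : Word s}
    (hu : IsLead a u) (hv : IsLead b v) : IsLead (a * b) (u * v) := by
  classical
  have hU : UniqueMul a.coeff.support b.coeff.support u v := by
    intro u' v' hu' hv' huv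
    have h1 := hu.2 u' (Finsupp.mem_support_iff.1 hu')
    have h2 := hv.2 v' (Finsupp.mem_support_iff.1 hv')
    have h3 : u' = u := by
      rcases h1.eq_or_lt with h | h
      · exact code_injective h
      · have := (code_mul_lt_mul_right (v := v') h).trans_le (code_mul_le_mul le_rfl h2)
        rw [huv] at this
        exact absurd this (lt_irrefl _)
    subst h3
    exact ⟨rfl, mul_left_cancel huv⟩
  constructor
  · rw [MonoidAlgebra.coeff_mul_mul_of_uniqueMul hU]
    exact mul_ne_zero hu.1 hv.1
  · intro w hw
    have := MonoidAlgebra.support_coeff_mul_subset (x := a) (y := b) (Finsupp.mem_support_iff.2 hw)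
    obtain ⟨x, hx, y, hy, rfl⟩ := Finset.mem_mul.1 this
    exact code_mul_le_mul (hu.2 x (Finsupp.mem_support_iff.1 hx))
      (hv.2 y (Finsupp.mem_support_iff.1 hy))

/-- A step of the Euclidean algorithm: if the leading word of `a` is a prefix of that of `b`, a
multiple of `b` can be brought below the leading word of `b` by a right multiple of `a`. -/
lemma IsLead.reduce [NoZeroDivisors O] [Nontrivial O] {a b : MonoidAlgebra O (Word s)}
    {u m : Word s}
    (hu : IsLead a u) (hv : IsLead b (u * m)) (v : Word s)
    (hne : (a.coeff u • b - b.coeff (u * m) • (a * MonoidAlgebra.single m 1)).coeff v ≠ 0) :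
    code v < code (u * m) := by
  have hm : IsLead (MonoidAlgebra.single m (1 : O)) m := by
    classical
    refine ⟨by simp, fun w hw => ?_⟩
    rw [MonoidAlgebra.coeff_single, Finsupp.single_apply] at hw
    split_ifs at hw with h
    · rw [h]
    · exact absurd rfl hw
  have h2 := hu.mul hm
  have hle : code v ≤ code (u * m) := by
    by_contra! hlt
    apply hne
    have e1 : b.coeff v = 0 := by
      by_contra h; exact absurd (hv.2 v h) (not_le.2 hlt)
    have e2 : (a * MonoidAlgebra.single m (1 : O)).coeff v = 0 := by
      by_contra h; exact absurd (h2.2 v h) (not_le.2 hlt)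
    simp [MonoidAlgebra.coeff_sub, MonoidAlgebra.coeff_smul, e1, e2]
  refine lt_of_le_of_ne hle fun h => hne ?_
  rw [code_injective h]
  simp only [MonoidAlgebra.coeff_sub, MonoidAlgebra.coeff_smul, Finsupp.sub_apply,
    Finsupp.smul_apply, smul_eq_mul]
  rw [MonoidAlgebra.coeff_mul_single_mul]
  ring

/-- Two elements with a nonzero common right multiple have, up to nonzero scalars of the domain `O`,
a common left divisor `p` in the right ideal that they generate. A common right multiple forces one
leading word to be a prefix of the other, so the Euclidean algorithm can proceed. -/
theorem exists_common_divisor [IsDomain O] {a b x y : MonoidAlgebra O (Word s)}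
    (hab : a * x = b * y) (h0 : a * x ≠ 0) :
    ∃ (p x' y' α β : MonoidAlgebra O (Word s)) (g : O), g ≠ 0 ∧
      g • a = p * x' ∧ g • b = p * y' ∧ g • p = a * α + b * β := by
  have key : ∀ (N : ℕ) (a b x y : MonoidAlgebra O (Word s)) (u v : Word s), IsLead a u →
      IsLead b v → code u + code v < N → a * x = b * y → a * x ≠ 0 →
      ∃ (p x' y' α β : MonoidAlgebra O (Word s)) (g : O), g ≠ 0 ∧
      g • a = p * x' ∧ g • b = p * y' ∧ g • p = a * α + b * β := by
    intro N
    induction N with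
    | zero => intro a b x y u v _ _ h; omega
    | succ N ih =>
      have step : ∀ (a b x y : MonoidAlgebra O (Word s)) (u m : Word s), IsLead a u →
          IsLead b (u * m) → code u + code (u * m) < N + 1 → a * x = b * y → a * x ≠ 0 →
          ∃ (p x' y' α β : MonoidAlgebra O (Word s)) (g : O), g ≠ 0 ∧
          g • a = p * x' ∧ g • b = p * y' ∧ g • p = a * α + b * β := by
        intro a b x y u m hu hv hN hab h0
        set A := a.coeff u with hA
        set B := b.coeff (u * m) with hB
        set M : MonoidAlgebra O (Word s) := MonoidAlgebra.single m 1
        set b₁ := A • b - B • (a * M) with hb₁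
        have hbeq : A • b = b₁ + B • (a * M) := by rw [hb₁]; abel
        -- `b₁ * y` is still a right multiple of `a`, so the recursion continues with
        -- `a` and `b₁`.
        by_cases h1 : b₁ = 0
        · refine ⟨a, A • 1, B • M, A • 1, 0, A, hu.1, ?_, ?_, ?_⟩
          · rw [mul_smul_comm, mul_one]
          · rw [hbeq, h1, zero_add, mul_smul_comm]
          · rw [mul_smul_comm, mul_one, mul_zero, add_zero]
        · obtain ⟨w, hw⟩ := exists_isLead h1
          have hlt := hu.reduce hv w hw.1
          have hy : y ≠ 0 := by rintro rfl; exact h0 (by rw [hab, mul_zero])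
          have heq : a * (A • x - B • (M * y)) = b₁ * y := by
            rw [hb₁, mul_sub, sub_mul, mul_smul_comm, mul_smul_comm, smul_mul_assoc,
              smul_mul_assoc, hab, mul_assoc]
          obtain ⟨p, x', y', α, β, g, hg, e1, e2, e3⟩ := ih a b₁ _ y u w hu hw (by omega) heq
            (by rw [heq]; exact mul_ne_zero h1 hy)
          refine ⟨p, A • x', y' + B • (x' * M), A • (α - B • (M * β)), A • A • β, g * A,
            mul_ne_zero hg hu.1, ?_, ?_, ?_⟩
          · rw [mul_comm, mul_smul, e1, mul_smul_comm]
          · rw [mul_smul, hbeq, smul_add, e2, smul_comm, ← smul_mul_assoc, e1, mul_add,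
              mul_smul_comm, mul_assoc]
          · rw [mul_comm, mul_smul, e3, hb₁]
            simp only [sub_mul, mul_sub, smul_mul_assoc, mul_smul_comm, mul_assoc, smul_sub,
              smul_add]
            abel
      intro a b x y u v hu hv hN hab h0
      have hx : x ≠ 0 := by rintro rfl; exact h0 (mul_zero _)
      have hy : y ≠ 0 := by rintro rfl; exact h0 (by rw [hab, mul_zero])
      obtain ⟨w, hw⟩ := exists_isLead hx
      obtain ⟨z, hz⟩ := exists_isLead hy
      have hl : u * w = v * z := (hu.mul hw).unique (hab ▸ hv.mul hz)
      rcases List.append_eq_append_iff.1 (congrArg FreeMonoid.toList hl) with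
        ⟨m, hm, -⟩ | ⟨m, hm, -⟩
      · have hm' : v = u * FreeMonoid.ofList m := FreeMonoid.toList.injective hm
        subst hm'
        exact step a b x y u _ hu hv hN hab h0
      · have hm' : u = v * FreeMonoid.ofList m := FreeMonoid.toList.injective hm
        subst hm'
        obtain ⟨p, x', y', α, β, g, hg, e1, e2, e3⟩ :=
          step b a y x v _ hv hu (by omega) hab.symm (hab ▸ h0)
        exact ⟨p, y', x', β, α, g, hg, e2, e1, by rw [e3, add_comm]⟩
  have ha : a ≠ 0 := by rintro rfl; exact h0 (zero_mul _)
  have hb : b ≠ 0 := by rintro rfl; exact h0 (by rw [hab, zero_mul])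
  obtain ⟨u, hu⟩ := exists_isLead ha
  obtain ⟨v, hv⟩ := exists_isLead hb
  exact key _ a b x y u v hu hv (Nat.lt_succ_self _) hab h0

end Lead

/-! ### A Gauss lemma for free algebras over `k[X]` -/

section Gauss
variable {k : Type*} [Field k] {s : ℕ}

/-- The inclusion of the free algebra over `k` in the free algebra over `k[X]`, as constants. -/
noncomputable def constHom (k : Type*) [Field k] (s : ℕ) :
    MonoidAlgebra k (Word s) →+* MonoidAlgebra k[X] (Word s) :=
  MonoidAlgebra.mapRingHom (Word s) (Polynomial.C : k →+* k[X])

/-- The free algebra over `k[X]`, viewed as the ring of polynomials over the free algebra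
over `k`. -/
noncomputable def toPoly (k : Type*) [Field k] (s : ℕ) :
    MonoidAlgebra k[X] (Word s) →+* (MonoidAlgebra k (Word s))[X] :=
  MonoidAlgebra.liftNCRingHom (Polynomial.mapRingHom (algebraMap k (MonoidAlgebra k (Word s))))
    ((Polynomial.C : MonoidAlgebra k (Word s) →+* _).toMonoidHom.comp (MonoidAlgebra.of k (Word s)))
    (fun p w => by
      refine Polynomial.ext fun n => ?_
      simp [Polynomial.coeff_mul_C, Polynomial.coeff_C_mul, MonoidAlgebra.coe_algebraMap,
        MonoidAlgebra.single_mul_single])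

lemma toPoly_single (w : Word s) (f : k[X]) :
    toPoly k s (MonoidAlgebra.single w f) =
      f.map (algebraMap k (MonoidAlgebra k (Word s))) *
        Polynomial.C (MonoidAlgebra.single w 1) := by
  simp [toPoly]

lemma coeff_toPoly (p : MonoidAlgebra k[X] (Word s)) (n : ℕ) (w : Word s) :
    ((toPoly k s p).coeff n).coeff w = (p.coeff w).coeff n := by
  classical
  induction p using MonoidAlgebra.induction_linear with
  | zero => simp
  | add a b ha hb => simp [ha, hb]
  | single u c =>
    rw [toPoly_single, Polynomial.coeff_mul_C, Polynomial.coeff_map]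
    simp only [MonoidAlgebra.coe_algebraMap, Function.comp_apply, MonoidAlgebra.single_mul_single,
      MonoidAlgebra.coeff_single, Finsupp.single_apply, one_mul, mul_one, Algebra.algebraMap_self,
      RingHom.id_apply]
    split_ifs <;> simp

lemma toPoly_injective : Function.Injective (toPoly k s) := by
  intro p q h
  ext w n
  rw [← coeff_toPoly, ← coeff_toPoly, h]

lemma toPoly_constHom (a : MonoidAlgebra k (Word s)) :
    toPoly k s (constHom k s a) = Polynomial.C a := by
  refine Polynomial.ext fun n => ?_
  ext w
  rw [coeff_toPoly, constHom, MonoidAlgebra.coeff_mapRingHom, Polynomial.coeff_C,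
    Polynomial.coeff_C]
  split_ifs <;> simp

lemma toPoly_smul (f : k[X]) (p : MonoidAlgebra k[X] (Word s)) :
    toPoly k s (f • p) = f.map (algebraMap k (MonoidAlgebra k (Word s))) * toPoly k s p := by
  have : f • p = MonoidAlgebra.single 1 f * p := by
    ext w; rw [MonoidAlgebra.coeff_single_one_mul]; rfl
  rw [this, map_mul, toPoly_single, ← MonoidAlgebra.one_def, map_one, mul_one]

/-- An element that vanishes modulo `π` is divisible by `π`. -/
lemma exists_eq_smul_of_dvd {π : k[X]} {p : MonoidAlgebra k[X] (Word s)}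
    (h : MonoidAlgebra.mapRingHom (Word s) (Ideal.Quotient.mk (Ideal.span {π})) p = 0) :
    ∃ q, p = π • q := by
  have hd : ∀ w, π ∣ p.coeff w := fun w => by
    rw [← Ideal.Quotient.eq_zero_iff_dvd, ← MonoidAlgebra.coeff_mapRingHom, h]; simp
  choose q hq using hd
  refine ⟨∑ w ∈ p.coeff.support, MonoidAlgebra.single w (q w), ?_⟩
  rw [Finset.smul_sum]
  conv_lhs => rw [← MonoidAlgebra.sum_coeff_single p]
  refine Finset.sum_congr rfl fun w _ => ?_
  rw [MonoidAlgebra.smul_single, smul_eq_mul, ← hq]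

/-- A Gauss lemma: a left divisor of a `k[X]`-multiple of a nonzero constant `E` is itself a
multiple of a constant. Prime factors `π` of `g` are cancelled one by one, as the free algebra over
`k[X] / (π)` is a domain; a left divisor of `E` itself has degree zero. -/
theorem exists_const_of_mul_eq {E : MonoidAlgebra k (Word s)} (hE : E ≠ 0)
    {p y : MonoidAlgebra k[X] (Word s)} {g : k[X]} (hg : g ≠ 0)
    (h : p * y = g • constHom k s E) :
    ∃ (l : k[X]) (p₀ : MonoidAlgebra k (Word s)), l ≠ 0 ∧ p = l • constHom k s p₀ := by
  have key : ∀ (N : ℕ) (p y : MonoidAlgebra k[X] (Word s)) (g : k[X]), g ≠ 0 →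
      g.natDegree < N → p * y = g • constHom k s E →
      ∃ (l : k[X]) (p₀ : MonoidAlgebra k (Word s)), l ≠ 0 ∧ p = l • constHom k s p₀ := by
    intro N
    induction N with
    | zero => intro p y g _ h; omega
    | succ N ih =>
      intro p y g hg hN h
      by_cases hu : IsUnit g
      · obtain ⟨c, hc, rfl⟩ := Polynomial.isUnit_iff.1 hu
        have h1 : toPoly k s p * toPoly k s y = Polynomial.C (c • E) := by
          rw [← map_mul, h, toPoly_smul, toPoly_constHom, Polynomial.map_C, ← Polynomial.C_mul,
            Algebra.smul_def]
        have hne : toPoly k s p * toPoly k s y ≠ 0 := by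
          rw [h1, Ne, Polynomial.C_eq_zero]
          exact smul_ne_zero hc.ne_zero hE
        have h2 := congrArg Polynomial.natDegree h1
        rw [Polynomial.natDegree_mul (left_ne_zero_of_mul hne) (right_ne_zero_of_mul hne),
          Polynomial.natDegree_C] at h2
        have h3 := Polynomial.eq_C_of_natDegree_eq_zero (p := toPoly k s p) (by omega)
        rw [← toPoly_constHom] at h3
        exact ⟨1, _, one_ne_zero, by rw [one_smul]; exact toPoly_injective h3⟩
      · obtain ⟨π, hπ, q, rfl⟩ := WfDvdMonoid.exists_irreducible_factor hu hg
        have hq : q ≠ 0 := right_ne_zero_of_mul hg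
        have hdeg : q.natDegree < N := by
          rw [Polynomial.natDegree_mul hπ.ne_zero hq] at hN
          have := hπ.natDegree_pos
          omega
        have hprime : (Ideal.span {π}).IsPrime := (Ideal.span_singleton_prime hπ.ne_zero).2 hπ.prime
        have hmod : MonoidAlgebra.mapRingHom (Word s) (Ideal.Quotient.mk (Ideal.span {π})) p *
            MonoidAlgebra.mapRingHom (Word s) (Ideal.Quotient.mk (Ideal.span {π})) y = 0 := by
          rw [← map_mul, h]
          ext w
          rw [MonoidAlgebra.coeff_mapRingHom, MonoidAlgebra.coeff_smul, Finsupp.smul_apply,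
            smul_eq_mul, (Ideal.Quotient.eq_zero_iff_dvd _ _).2
              ⟨q * (constHom k s E).coeff w, by ring⟩]
          rfl
        have hcancel : ∀ a b : MonoidAlgebra k[X] (Word s), π • a = π • b → a = b :=
          fun a b hab => smul_right_injective _ hπ.ne_zero hab
        rcases mul_eq_zero.1 hmod with h1 | h1
        · obtain ⟨p₁, rfl⟩ := exists_eq_smul_of_dvd h1
          obtain ⟨l, p₀, hl, rfl⟩ := ih p₁ y q hq hdeg
            (hcancel _ _ (by rw [← smul_mul_assoc, h, mul_smul]))
          exact ⟨π * l, p₀, mul_ne_zero hπ.ne_zero hl, by rw [mul_smul]⟩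
        · obtain ⟨y₁, rfl⟩ := exists_eq_smul_of_dvd h1
          exact ih p y₁ q hq hdeg (hcancel _ _ (by rw [← mul_smul_comm, h, mul_smul]))
  exact key _ p y g hg (Nat.lt_succ_self _) h

end Gauss

/-! ### Linear families with a constant divisor -/

section Family
variable {k : Type*} [Field k] {s : ℕ}

/-- Polynomials with scalar coefficients are central in `A[X]`. -/
lemma map_algebraMap_commute {A : Type*} [Ring A] [Algebra k A] (g : k[X]) (p : A[X]) :
    Commute (g.map (algebraMap k A)) p := by
  induction g using Polynomial.induction_on' with
  | add f g hf hg => rw [Polynomial.map_add]; exact hf.add_left hg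
  | monomial n c =>
    rw [Polynomial.map_monomial, ← Polynomial.C_mul_X_pow_eq_monomial]
    refine Commute.mul_left ?_ ((Polynomial.commute_X p).pow_left n)
    refine Polynomial.ext fun m => ?_
    rw [Polynomial.coeff_C_mul, Polynomial.coeff_mul_C, Algebra.commutes]

/-- If `a` and `d` commute with `E`, a single `p` divides `a` and `d` on the left and lies, up to a
factor `g` in `k[X]`, in the right ideal generated by `a - X d` and `E`. -/
theorem exists_const_common_divisor {a d E : MonoidAlgebra k (Word s)} (haE : a * E = E * a)
    (hdE : d * E = E * d) (hd : d ≠ 0) (hE : E ≠ 0) :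
    ∃ p : MonoidAlgebra k (Word s), (∃ d', d = p * d') ∧ (∃ a', a = p * a') ∧
      ∃ (g : k[X]) (α β : (MonoidAlgebra k (Word s))[X]), g ≠ 0 ∧
        g.map (algebraMap k (MonoidAlgebra k (Word s))) * Polynomial.C p =
          (Polynomial.C a - Polynomial.X * Polynomial.C d) * α + Polynomial.C E * β := by
  set b : MonoidAlgebra k[X] (Word s) := constHom k s a - (Polynomial.X : k[X]) • constHom k s d
    with hb
  have hψb : toPoly k s b = Polynomial.C a - Polynomial.X * Polynomial.C d := by
    rw [hb, map_sub, toPoly_smul, toPoly_constHom, toPoly_constHom, Polynomial.map_X]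
  have hcomm : b * constHom k s E = constHom k s E * b := by
    rw [hb, sub_mul, mul_sub, smul_mul_assoc, mul_smul_comm, ← map_mul, ← map_mul, ← map_mul,
      ← map_mul, haE, hdE]
  have hb0 : b ≠ 0 := by
    intro h
    have h1 := congrArg (fun q : (MonoidAlgebra k (Word s))[X] => q.coeff 1) hψb
    rw [h] at h1
    simp [Polynomial.coeff_C] at h1
    exact hd h1
  have hE0 : constHom k s E ≠ 0 := by
    intro h
    have h1 := toPoly_constHom E
    rw [h, map_zero, eq_comm, Polynomial.C_eq_zero] at h1
    exact hE h1
  -- `b * E = E * b` is the nonzero common right multiple.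
  obtain ⟨p, x, y, α, β, G, hG, e1, e2, e3⟩ :=
    exists_common_divisor hcomm (mul_ne_zero hb0 hE0)
  obtain ⟨l, p₀, hl, rfl⟩ := exists_const_of_mul_eq hE hG e2.symm
  have e1' := congrArg (toPoly k s) e1
  have e3' := congrArg (toPoly k s) e3
  rw [toPoly_smul, smul_mul_assoc, toPoly_smul, map_mul, toPoly_constHom, hψb] at e1'
  rw [← mul_smul, toPoly_smul, map_add, map_mul, map_mul, toPoly_constHom, toPoly_constHom,
    hψb] at e3'
  have e4 : G.map (algebraMap k (MonoidAlgebra k (Word s))) *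
      (Polynomial.C a - Polynomial.X * Polynomial.C d) =
      Polynomial.C p₀ * (l.map (algebraMap k _) * toPoly k s x) := by
    rw [e1', ← mul_assoc, ← mul_assoc, (map_algebraMap_commute l _).eq]
  set n := G.natDegree with hn
  have hc0 : G.coeff n ≠ 0 := by rw [hn]; exact Polynomial.leadingCoeff_ne_zero.2 hG
  have key : ∀ m, (G.map (algebraMap k (MonoidAlgebra k (Word s))) *
      (Polynomial.C a - Polynomial.X * Polynomial.C d)).coeff (m + 1) =
      G.coeff (m + 1) • a - G.coeff m • d := by
    intro m
    rw [mul_sub, Polynomial.coeff_sub, Polynomial.coeff_mul_C, ← mul_assoc, Polynomial.coeff_mul_C,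
      Polynomial.coeff_mul_X, Polynomial.coeff_map, Polynomial.coeff_map, Algebra.smul_def,
      Algebra.smul_def]
  -- Comparing coefficients in `G (a - X d) = p₀ (…)`: the one of degree `n + 1` is a multiple
  -- of `d`, and the one of degree `n` then yields `a`.
  have hpd : ∃ d', d = p₀ * d' := by
    have h1 := key n
    rw [e4, Polynomial.coeff_C_mul, Polynomial.coeff_eq_zero_of_natDegree_lt (p := G) (by omega),
      zero_smul, zero_sub] at h1
    refine ⟨-((G.coeff n)⁻¹ • (l.map (algebraMap k _) * toPoly k s x).coeff (n + 1)), ?_⟩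
    rw [mul_neg, mul_smul_comm, h1, smul_neg, neg_neg, inv_smul_smul₀ hc0]
  refine ⟨p₀, hpd, ?_, G * l, _, _, mul_ne_zero hG hl, e3'⟩
  obtain ⟨d', hd'⟩ := hpd
  rcases Nat.eq_zero_or_pos n with h0 | h0
  · have h1 : (G.map (algebraMap k (MonoidAlgebra k (Word s))) *
      (Polynomial.C a - Polynomial.X * Polynomial.C d)).coeff 0 = G.coeff 0 • a := by
      rw [mul_sub, Polynomial.coeff_sub, Polynomial.coeff_mul_C, ← mul_assoc,
        Polynomial.coeff_mul_C, Polynomial.coeff_mul_X_zero, Polynomial.coeff_map, zero_mul,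
        sub_zero, Algebra.smul_def]
    rw [e4, Polynomial.coeff_C_mul] at h1
    refine ⟨(G.coeff 0)⁻¹ • (l.map (algebraMap k _) * toPoly k s x).coeff 0, ?_⟩
    rw [mul_smul_comm, h1, inv_smul_smul₀ (h0 ▸ hc0)]
  · obtain ⟨m, hm⟩ := Nat.exists_eq_succ_of_ne_zero h0.ne'
    have h1 := key m
    rw [Nat.succ_eq_add_one] at hm
    rw [e4, Polynomial.coeff_C_mul, ← hm] at h1
    refine ⟨(G.coeff n)⁻¹ • ((l.map (algebraMap k _) * toPoly k s x).coeff n +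
      G.coeff m • d'), ?_⟩
    rw [mul_smul_comm, mul_add, h1, mul_smul_comm, ← hd', sub_add_cancel, inv_smul_smul₀ hc0]

/-- `∑ eₙ ∑_{i < n} δ_{n - 1 - i} X ^ i`. For `δ i = u ^ i` this is the divided difference
`(e(X) - e(u)) / (X - u)`, and for `δ i = D * u ^ i` it is `D` times that; with a sequence as
argument it makes sense in a ring containing all `D * u ^ i` but not `u`. -/
noncomputable def dividedDiff {R : Type*} [CommRing R] [Algebra k R] (e : k[X]) (δ : ℕ → R) :
    R[X] :=
  ∑ n ∈ Finset.range (e.natDegree + 1), ∑ i ∈ Finset.range n,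
    Polynomial.C (e.coeff n • δ (n - 1 - i)) * Polynomial.X ^ i

lemma dividedDiff_mul {R : Type*} [CommRing R] [Algebra k R] (e : k[X]) (u : R) :
    dividedDiff e (fun i => u ^ i) * (Polynomial.X - Polynomial.C u) =
      e.map (algebraMap k R) - Polynomial.C (Polynomial.aeval u e) := by
  have h1 : e.map (algebraMap k R) = ∑ n ∈ Finset.range (e.natDegree + 1),
      Polynomial.C (algebraMap k R (e.coeff n)) * Polynomial.X ^ n := by
    conv_lhs => rw [e.as_sum_range_C_mul_X_pow]
    simp [Polynomial.map_sum]
  rw [h1, Polynomial.aeval_eq_sum_range, map_sum, ← Finset.sum_sub_distrib, dividedDiff,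
    Finset.sum_mul]
  refine Finset.sum_congr rfl fun n _ => ?_
  have h2 := (Commute.all (Polynomial.X : R[X]) (Polynomial.C u)).geom_sum₂_mul n
  rw [Algebra.smul_def, Polynomial.C_mul, ← mul_sub, map_pow, ← h2, ← mul_assoc, Finset.mul_sum]
  congr 1
  refine Finset.sum_congr rfl fun i _ => ?_
  rw [Algebra.smul_def, Polynomial.C_mul, Polynomial.C_pow]
  ring

lemma dividedDiff_mul_C {R : Type*} [CommRing R] [Algebra k R] (e : k[X]) (δ : ℕ → R) (r : R) :
    dividedDiff e δ * Polynomial.C r = dividedDiff e (fun i => r * δ i) := by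
  simp only [dividedDiff, Finset.sum_mul]
  refine Finset.sum_congr rfl fun n _ => Finset.sum_congr rfl fun i _ => ?_
  rw [← mul_smul_comm, Polynomial.C_mul]
  ring

lemma map_dividedDiff {R S : Type*} [CommRing R] [Algebra k R] [CommRing S] [Algebra k S]
    (f : R →ₐ[k] S) (e : k[X]) (δ : ℕ → R) :
    (dividedDiff e δ).map (f : R →+* S) = dividedDiff e (fun i => f (δ i)) := by
  simp [dividedDiff, Polynomial.map_sum]

end Family

/-! ### Quotients through divided differences -/

section Family
variable {k : Type*} [Field k] {s : ℕ}

/-- `σ (a - X D) ∈ D ^ 2 R[X]`, for `σ = D (e(X) - e(u)) / (X - u)` and `a = D u`. -/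
lemma dividedDiff_mul_linear {R : Type*} [CommRing R] [IsDomain R] [Algebra k R]
    {j : R →ₐ[k] k[X]} (hj : Function.Injective j) {u : k[X]} {δ ε : ℕ → R} {e : k[X]}
    (hδ : ∀ i, j (δ i) = j (δ 0) * u ^ i)
    (hε : ∀ i, j (ε i) = u ^ i * Polynomial.aeval u e) :
    dividedDiff e δ * (Polynomial.C (δ 1) - Polynomial.X * Polynomial.C (δ 0)) =
      Polynomial.C (δ 0 * δ 0) * (Polynomial.C (ε 0) - e.map (algebraMap k R)) := by
  apply Polynomial.map_injective (j : R →+* k[X]) hj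
  have h1 := dividedDiff_mul e u
  have h2 : (dividedDiff e δ).map (j : R →+* k[X]) =
      dividedDiff e (fun i => u ^ i) * Polynomial.C (j (δ 0)) := by
    rw [map_dividedDiff j e δ, dividedDiff_mul_C]
    congr 1
    funext i
    exact hδ i
  have h3 : (e.map (algebraMap k R)).map (j : R →+* k[X]) = e.map (algebraMap k k[X]) := by
    rw [Polynomial.map_map]; congr 1; ext r; simp
  simp only [Polynomial.map_mul, Polynomial.map_sub, Polynomial.map_C, Polynomial.map_X, h2, h3]
  simp only [RingHom.coe_coe, map_mul, hδ 1, hε 0, pow_one,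
    pow_zero, one_mul]
  linear_combination (-Polynomial.C (j (δ 0)) * Polynomial.C (j (δ 0))) * h1

/-- `σ * (D e(u)) ∈ D ^ 2 R[X]`, for `σ = D (e(X) - e(u)) / (X - u)`. -/
lemma dividedDiff_mul_const {R : Type*} [CommRing R] [IsDomain R] [Algebra k R]
    {j : R →ₐ[k] k[X]} (hj : Function.Injective j) {u : k[X]} {δ ε : ℕ → R} {e : k[X]}
    (hδ : ∀ i, j (δ i) = j (δ 0) * u ^ i)
    (hε : ∀ i, j (ε i) = u ^ i * Polynomial.aeval u e) :
    dividedDiff e δ * Polynomial.C (δ 0 * ε 0) =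
      Polynomial.C (δ 0 * δ 0) * dividedDiff e ε := by
  rw [mul_comm (Polynomial.C (δ 0 * δ 0)), dividedDiff_mul_C, dividedDiff_mul_C]
  congr 1
  funext i
  refine hj ?_
  simp only [map_mul]
  rw [hδ i, hε i, hε 0]
  ring

lemma leadingCoeff_dividedDiff {R : Type*} [CommRing R] [IsDomain R] [Algebra k R]
    {j : R →ₐ[k] k[X]} (hj : Function.Injective j) {u : k[X]} {δ ε : ℕ → R} {e : k[X]}
    (he : e.natDegree ≠ 0) (hδ0 : δ 0 ≠ 0)
    (hδ : ∀ i, j (δ i) = j (δ 0) * u ^ i)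
    (hε : ∀ i, j (ε i) = u ^ i * Polynomial.aeval u e) :
    (dividedDiff e δ).leadingCoeff = e.leadingCoeff • δ 0 := by
  have h1 := congrArg Polynomial.leadingCoeff (dividedDiff_mul_linear hj hδ hε)
  have hem : (e.map (algebraMap k R)).natDegree = e.natDegree :=
    Polynomial.natDegree_map _
  have h2 : (Polynomial.C (δ 1) - Polynomial.X * Polynomial.C (δ 0)).leadingCoeff = -δ 0 := by
    have h3 : (Polynomial.C (δ 1) - Polynomial.X * Polynomial.C (δ 0) : R[X]) =
      Polynomial.C (-δ 0) * Polynomial.X + Polynomial.C (δ 1) := by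
      rw [Polynomial.C_neg]; ring
    rw [h3, Polynomial.leadingCoeff_linear (neg_ne_zero.2 hδ0)]
  have h4 : (Polynomial.C (ε 0) - e.map (algebraMap k R)).leadingCoeff =
      -algebraMap k R e.leadingCoeff := by
    rw [← neg_sub, Polynomial.leadingCoeff_neg, Polynomial.leadingCoeff_sub_of_degree_lt,
      Polynomial.leadingCoeff_map]
    refine Polynomial.degree_C_le.trans_lt ?_
    rw [← Polynomial.natDegree_pos_iff_degree_pos, hem]
    omega
  rw [Polynomial.leadingCoeff_mul, Polynomial.leadingCoeff_mul, h2, h4,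
    Polynomial.leadingCoeff_C] at h1
  refine mul_right_cancel₀ (neg_ne_zero.2 hδ0) (h1.trans ?_)
  rw [Algebra.smul_def]
  ring

/-- Let `R` embed both in `k[X]` and in the free algebra, and let `δ i = D u ^ i` and
`ε i = u ^ i e(u)` belong to `R`. Then `D u` is a right multiple of `D` in the free algebra. -/
theorem exists_eq_mul_of_dividedDiff {R : Type*} [CommRing R] [IsDomain R] [Algebra k R]
    {j : R →ₐ[k] k[X]} (hj : Function.Injective j)
    (ι : R →ₐ[k] MonoidAlgebra k (Word s)) (hι : Function.Injective ι)
    (u : k[X]) (δ ε : ℕ → R) (e : k[X]) (he : e.natDegree ≠ 0)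
    (hδ0 : δ 0 ≠ 0) (hε0 : ε 0 ≠ 0) (hδ : ∀ i, j (δ i) = j (δ 0) * u ^ i)
    (hε : ∀ i, j (ε i) = u ^ i * Polynomial.aeval u e) :
    ∃ y, ι (δ 1) = ι (δ 0) * y := by
  have hmul_ne : δ 0 * ε 0 ≠ 0 := mul_ne_zero hδ0 hε0
  have hι0 : ∀ r, r ≠ 0 → ι r ≠ 0 := fun r hr h => hr (hι (by rw [h, map_zero]))
  obtain ⟨p, -, ⟨a', ha'⟩, g, α, β, hg, hgp⟩ := exists_const_common_divisor
    (a := ι (δ 1)) (d := ι (δ 0)) (E := ι (δ 0 * ε 0))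
    (by rw [← map_mul, ← map_mul, mul_comm]) (by rw [← map_mul, ← map_mul, mul_comm])
    (hι0 _ hδ0) (hι0 _ hmul_ne)
  have id1 := dividedDiff_mul_linear hj hδ hε
  have id2 := dividedDiff_mul_const hj hδ hε
  have hlead := leadingCoeff_dividedDiff hj he hδ0 hδ hε
  generalize dividedDiff e δ = σ at id1 id2 hlead
  generalize dividedDiff e ε = ρ at id2
  generalize Polynomial.C (ε 0) - e.map (algebraMap k R) = τ at id1
  obtain ⟨J, hJ⟩ : ∃ J, J = Polynomial.mapRingHom (ι : R →+* MonoidAlgebra k (Word s)) := ⟨_, rfl⟩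
  have hJC : ∀ r, J (Polynomial.C r) = Polynomial.C (ι r) := fun r => by simp [hJ]
  have hJX : J Polynomial.X = Polynomial.X := by simp [hJ]
  have hJg : J (g.map (algebraMap k R)) = g.map (algebraMap k _) := by
    rw [hJ, Polynomial.coe_mapRingHom, Polynomial.map_map]
    congr 1
    ext r
    simp
  have id1' := congrArg J id1
  have id2' := congrArg J id2
  rw [J.map_mul σ, J.map_mul (Polynomial.C _), J.map_sub, J.map_mul Polynomial.X, hJC, hJC, hJC,
    hJX] at id1'
  rw [J.map_mul σ, J.map_mul (Polynomial.C _), hJC, hJC] at id2'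
  have hfin : J (σ * g.map (algebraMap k R)) * Polynomial.C p =
      Polynomial.C (ι (δ 0 * δ 0)) * (J τ * α + J ρ * β) := by
    rw [J.map_mul, hJg, mul_assoc, hgp, mul_add, ← mul_assoc, ← mul_assoc, id1', id2', mul_assoc,
      mul_assoc, mul_add]
  -- The leading coefficient of `σ * g` is a scalar times `D`, so this coefficient of `hfin` reads
  -- `D p ∈ D ^ 2 A` up to a scalar.
  have hcoef := congrArg (fun q : (MonoidAlgebra k (Word s))[X] =>
    q.coeff (σ * g.map (algebraMap k R)).natDegree) hfin
  beta_reduce at hcoef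
  rw [Polynomial.coeff_mul_C, Polynomial.coeff_C_mul, hJ, Polynomial.coe_mapRingHom,
    Polynomial.coeff_map, Polynomial.coeff_natDegree,
    Polynomial.leadingCoeff_mul, hlead, Polynomial.leadingCoeff_map, RingHom.coe_coe, mul_comm,
    ← Algebra.smul_def, map_smul, map_smul, smul_smul, map_mul, mul_assoc, smul_mul_assoc,
    ← mul_smul_comm] at hcoef
  have hp := mul_left_cancel₀ (hι0 _ hδ0) hcoef
  have hne : g.leadingCoeff * e.leadingCoeff ≠ 0 := by
    refine mul_ne_zero (Polynomial.leadingCoeff_ne_zero.2 hg) (Polynomial.leadingCoeff_ne_zero.2 ?_)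
    rintro rfl
    simp at he
  rw [← eq_inv_smul_iff₀ hne] at hp
  rw [ha', hp]
  exact ⟨_, by rw [← mul_smul_comm, mul_assoc]⟩

end Family

/-! ### Subalgebras of `k[X]`: denominators and conductors -/

section Luroth
variable {k : Type*} [Field k]

lemma isIntegral_X_of_mem {S : Subalgebra k k[X]} {u : k[X]} (hu : u ∈ S) (hd : u.natDegree ≠ 0) :
    IsIntegral S (Polynomial.X : k[X]) := by
  have hu0 : u.leadingCoeff ≠ 0 := by
    rw [Polynomial.leadingCoeff_ne_zero]; rintro rfl; simp at hd
  set v : k[X] := Polynomial.C u.leadingCoeff⁻¹ * u with hv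
  have hvS : v ∈ S := by
    rw [hv, ← Polynomial.smul_eq_C_mul]; exact S.smul_mem hu _
  have hvm : v.Monic := by
    rw [hv, mul_comm]; exact Polynomial.monic_mul_leadingCoeff_inv (by rintro rfl; simp at hd)
  have hvd : v.natDegree = u.natDegree := by
    rw [hv, Polynomial.natDegree_C_mul (inv_ne_zero hu0)]
  refine ⟨v.map (algebraMap k S) - Polynomial.C ⟨v, hvS⟩, ?_, ?_⟩
  · refine (hvm.map _).sub_of_left (Polynomial.degree_C_le.trans_lt ?_)
    rw [Polynomial.degree_map, ← Polynomial.natDegree_pos_iff_degree_pos, hvd]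
    omega
  · rw [Polynomial.eval₂_sub, Polynomial.eval₂_C, Polynomial.eval₂_map, sub_eq_zero]
    change Polynomial.eval₂ _ _ v = v
    exact Polynomial.eval₂_C_X

lemma isIntegral_of_mem {S : Subalgebra k k[X]} {u : k[X]} (hu : u ∈ S) (hd : u.natDegree ≠ 0)
    (q : k[X]) : IsIntegral S q := by
  have hX := isIntegral_X_of_mem hu hd
  induction q using Polynomial.induction_on' with
  | add p q hp hq => exact hp.add hq
  | monomial n c =>
    rw [← Polynomial.smul_X_eq_monomial]
    have : c • (Polynomial.X : k[X]) ^ n = (algebraMap k S c) • Polynomial.X ^ n := by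
      rw [algebraMap_smul]
    rw [this]
    exact (hX.pow n).smul _

/-- All powers of a quotient `u = (d * u) / d` have a common denominator in `R`, since `u` is
integral over `R`. -/
lemma exists_denominator {R : Subalgebra k k[X]} {r : k[X]} (hr : r ∈ R) (hrd : r.natDegree ≠ 0)
    {d u : k[X]} (hd : d ∈ R) (hd0 : d ≠ 0) (hdu : d * u ∈ R) :
    ∃ D ∈ R, D ≠ 0 ∧ ∀ i, D * u ^ i ∈ R := by
  obtain ⟨P, hP, hPu⟩ := isIntegral_of_mem hr hrd u
  refine ⟨d ^ P.natDegree, pow_mem hd _, pow_ne_zero _ hd0, fun i => ?_⟩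
  induction i using Nat.strong_induction_on with
  | _ i ih =>
    rcases le_or_gt i P.natDegree with h | h
    · have : d ^ P.natDegree * u ^ i = d ^ (P.natDegree - i) * (d * u) ^ i := by
        rw [mul_pow, ← mul_assoc, ← pow_add, Nat.sub_add_cancel h]
      rw [this]
      exact mul_mem (pow_mem hd _) (pow_mem hdu _)
    · have h1 : u ^ P.natDegree =
          -∑ j ∈ Finset.range P.natDegree, (P.coeff j : k[X]) * u ^ j := by
        rw [hP.as_sum] at hPu
        simp only [Polynomial.eval₂_add, Polynomial.eval₂_X_pow, Polynomial.eval₂_finsetSum,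
          Polynomial.eval₂_mul, Polynomial.eval₂_C] at hPu
        exact eq_neg_of_add_eq_zero_left hPu
      have h2 : d ^ P.natDegree * u ^ i = -∑ j ∈ Finset.range P.natDegree,
          (P.coeff j : k[X]) * (d ^ P.natDegree * u ^ (i - P.natDegree + j)) := by
        have e1 : u ^ i = u ^ (i - P.natDegree) * u ^ P.natDegree := by
          rw [← pow_add, Nat.sub_add_cancel h.le]
        rw [e1, h1, mul_neg, mul_neg, Finset.mul_sum, Finset.mul_sum]
        refine congrArg Neg.neg (Finset.sum_congr rfl fun j _ => ?_)
        rw [pow_add, mul_left_comm (u ^ _), mul_left_comm]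
      rw [h2]
      refine neg_mem (sum_mem fun j hj => mul_mem (P.coeff j).2 (ih _ ?_))
      have := Finset.mem_range.1 hj
      omega

lemma mul_aeval_mem {R : Subalgebra k k[X]} {D u : k[X]} (h : ∀ i, D * u ^ i ∈ R) (e : k[X])
    (i : ℕ) : D * u ^ i * Polynomial.aeval u e ∈ R := by
  induction e using Polynomial.induction_on' with
  | add p q hp hq => rw [map_add, mul_add]; exact add_mem hp hq
  | monomial n c =>
    rw [Polynomial.aeval_monomial, ← Algebra.smul_def, mul_smul_comm, mul_assoc, ← pow_add]
    exact R.smul_mem (h _) _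

/-- `R` contains a nonzero ideal of `k[u]`. Indeed `D` is algebraic over `k[u]`, so some nonzero
`e(u)` is a multiple of `D` by an element of `k[u][D]`. -/
lemma exists_conductor {R : Subalgebra k k[X]} {D u : k[X]} (hD : D ∈ R) (hD0 : D ≠ 0)
    (h : ∀ i, D * u ^ i ∈ R) (hu : u.natDegree ≠ 0) :
    ∃ e : k[X], e.natDegree ≠ 0 ∧ Polynomial.aeval u e ≠ 0 ∧
      ∀ i, u ^ i * Polynomial.aeval u e ∈ R := by
  have hu0 : u ≠ 0 := by rintro rfl; simp at hu
  have halg : IsAlgebraic (Polynomial.aeval (R := k) u).range D :=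
    (isIntegral_of_mem (S := (Polynomial.aeval (R := k) u).range) (u := u) ⟨Polynomial.X, by simp⟩
      hu D).isAlgebraic
  obtain ⟨t, ht, ⟨_, e, rfl⟩, he0, hDt⟩ :=
    halg.exists_nonzero_eq_adjoin_mul (mem_nonZeroDivisors_of_ne_zero hD0)
  have hDt' : D * t = Polynomial.aeval u e := hDt
  have he1 : Polynomial.aeval u e ≠ 0 := fun h => he0 (Subtype.ext h)
  have hmem : ∀ i, D * u ^ i * t ∈ R := by
    rw [Algebra.adjoin_singleton_eq_range_aeval] at ht
    obtain ⟨P, rfl⟩ := ht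
    clear hDt hDt'
    intro i
    change D * u ^ i * Polynomial.aeval D P ∈ R
    induction P using Polynomial.induction_on' with
    | add p q hp hq => rw [map_add, mul_add]; exact add_mem hp hq
    | monomial n c =>
      obtain ⟨_, e', rfl⟩ := c
      rw [Polynomial.aeval_monomial, ← mul_assoc]
      exact mul_mem (mul_aeval_mem h e' i) (pow_mem hD n)
  -- The factor `X` makes the polynomial nonconstant even if `e` is a scalar.
  refine ⟨e * Polynomial.X, ?_, ?_, fun i => ?_⟩
  · rw [Polynomial.natDegree_mul_X (by rintro rfl; simp at he1)]; omega
  · rw [map_mul, Polynomial.aeval_X]; exact mul_ne_zero he1 hu0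
  · have := hmem (i + 1)
    rw [map_mul, Polynomial.aeval_X, ← hDt']
    convert this using 1
    ring

/-- If `R` contains every polynomial that is a quotient of two of its elements, it is integrally
closed, because `k[X]` is. -/
theorem isIntegrallyClosed_of_forall_mem {R : Subalgebra k k[X]}
    (hN : ∀ d u : k[X], d ∈ R → d ≠ 0 → d * u ∈ R → u ∈ R) : IsIntegrallyClosed R := by
  rw [isIntegrallyClosed_iff (FractionRing R)]
  intro x hx
  obtain ⟨a, b, hb, rfl⟩ := IsFractionRing.div_surjective (A := R) x
  have hinj : Function.Injective ((algebraMap k[X] (FractionRing k[X])).comp R.val.toRingHom) :=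
    (IsFractionRing.injective k[X] (FractionRing k[X])).comp Subtype.val_injective
  have hb0 : (b : k[X]) ≠ 0 := fun h => nonZeroDivisors.ne_zero hb (Subtype.ext h)
  have h1 := hx.map_of_comp_eq R.val.toRingHom (IsFractionRing.lift (K := FractionRing R) hinj)
    (by ext r; simp [IsFractionRing.lift_algebraMap])
  obtain ⟨u, hu⟩ := IsIntegrallyClosed.isIntegral_iff.1 h1
  rw [map_div₀, IsFractionRing.lift_algebraMap, IsFractionRing.lift_algebraMap] at hu
  have hb1 : algebraMap k[X] (FractionRing k[X]) b ≠ 0 := by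
    rw [Ne, map_eq_zero_iff _ (IsFractionRing.injective k[X] (FractionRing k[X]))]; exact hb0
  have h2 : (b : k[X]) * u = a := by
    apply IsFractionRing.injective k[X] (FractionRing k[X])
    rw [map_mul, hu]
    exact mul_div_cancel₀ _ hb1
  have huR := hN b u b.2 hb0 (h2 ▸ a.2)
  refine ⟨⟨u, huR⟩, ?_⟩
  have h3 : a = b * ⟨u, huR⟩ := Subtype.ext h2.symm
  rw [h3, map_mul, mul_div_cancel_left₀]
  rw [Ne, map_eq_zero_iff _ (IsFractionRing.injective R (FractionRing R))]
  exact nonZeroDivisors.ne_zero hb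

end Luroth

/-! ### Integrally closed subalgebras of `k[X]` -/

section Luroth
variable {k : Type*} [Field k]

/-- `Polynomial.Bivariate.swap` exchanges the two exponents. -/
lemma coeff_coeff_swap (p : k[X][X]) (i j : ℕ) :
    ((Polynomial.Bivariate.swap p).coeff i).coeff j = (p.coeff j).coeff i := by
  induction p using Polynomial.induction_on' with
  | add p q hp hq => simp only [map_add, Polynomial.coeff_add, hp, hq]
  | monomial n f =>
    induction f using Polynomial.induction_on' with
    | add p q hp hq =>
      simp only [map_add, Polynomial.coeff_add, hp, hq]
    | monomial m c =>
      rw [Polynomial.Bivariate.swap_monomial_monomial]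
      simp only [Polynomial.coeff_monomial]
      split_ifs <;> simp_all [Polynomial.coeff_monomial]

/-- Write `x` for the variable of the coefficients. If `M` divides `c(X) - c(x)` and has a
coefficient of the same degree in `x` as `c`, then it has the same degree in `X` too. In fact the
cofactor has degree zero in `x`, and divides the coefficient of the highest power of `x`,
a nonzero scalar. -/
lemma natDegree_eq_zero_of_mul_eq {c : k[X]} {M H : k[X][X]}
    (h : M * H = c.map Polynomial.C - Polynomial.C c) {i : ℕ}
    (hi : (M.coeff i).natDegree = c.natDegree) (hc : c.natDegree ≠ 0) : H.natDegree = 0 := by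
  have hP : ∀ j n, ((c.map Polynomial.C - Polynomial.C c : k[X][X]).coeff j).coeff n =
      (if n = 0 then c.coeff j else 0) - if j = 0 then c.coeff n else 0 := by
    intro j n
    rw [Polynomial.coeff_sub, Polynomial.coeff_map, Polynomial.coeff_C, Polynomial.coeff_sub,
      Polynomial.coeff_C]
    split_ifs <;> simp
  have h' := congrArg Polynomial.Bivariate.swap h
  rw [map_mul] at h'
  set M' := Polynomial.Bivariate.swap M with hM'
  set H' := Polynomial.Bivariate.swap H with hH'
  set P' := Polynomial.Bivariate.swap (c.map Polynomial.C - Polynomial.C c) with hP'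
  have hPc : ∀ n j, (P'.coeff n).coeff j =
      (if n = 0 then c.coeff j else 0) - if j = 0 then c.coeff n else 0 := fun n j => by
    rw [hP', coeff_coeff_swap, hP]
  have hPlead : P'.coeff c.natDegree = Polynomial.C (-c.leadingCoeff) := by
    ext j
    rw [hPc, if_neg hc, Polynomial.coeff_C]
    split_ifs <;> simp
  have hc0 : c ≠ 0 := by rintro rfl; simp at hc
  have hPdeg : P'.natDegree ≤ c.natDegree := by
    rw [Polynomial.natDegree_le_iff_coeff_eq_zero]
    intro n hn
    ext j
    rw [hPc, if_neg (by omega), Polynomial.coeff_eq_zero_of_natDegree_lt hn]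
    simp
  have hPne : P' ≠ 0 := by
    intro h0
    rw [h0, Polynomial.coeff_zero, eq_comm, Polynomial.C_eq_zero, neg_eq_zero,
      Polynomial.leadingCoeff_eq_zero] at hPlead
    exact hc0 hPlead
  have hM'ne : M' ≠ 0 := by rintro h0; rw [h0, zero_mul] at h'; exact hPne h'.symm
  have hH'ne : H' ≠ 0 := by rintro h0; rw [h0, mul_zero] at h'; exact hPne h'.symm
  have hMdeg : c.natDegree ≤ M'.natDegree := by
    apply Polynomial.le_natDegree_of_ne_zero
    intro h0
    have h1 := coeff_coeff_swap M c.natDegree i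
    rw [← hM', h0, Polynomial.coeff_zero, ← hi, Polynomial.coeff_natDegree, eq_comm,
      Polynomial.leadingCoeff_eq_zero] at h1
    rw [h1, Polynomial.natDegree_zero] at hi
    exact hc hi.symm
  have hdeg := congrArg Polynomial.natDegree h'
  rw [Polynomial.natDegree_mul hM'ne hH'ne] at hdeg
  have hH0 : H'.natDegree = 0 := by omega
  have hMe : M'.natDegree = c.natDegree := by omega
  obtain ⟨a, ha⟩ : ∃ a, H' = Polynomial.C a := ⟨_, Polynomial.eq_C_of_natDegree_eq_zero hH0⟩
  have hu : M'.coeff c.natDegree * a = Polynomial.C (-c.leadingCoeff) := by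
    rw [← hPlead, ← h', ha, Polynomial.coeff_mul_C]
  have hau : IsUnit a := isUnit_of_mul_isUnit_right (x := M'.coeff c.natDegree) (by
    rw [hu]
    exact Polynomial.isUnit_C.2 (neg_ne_zero.2 (Polynomial.leadingCoeff_ne_zero.2 hc0)).isUnit)
  obtain ⟨b, -, rfl⟩ := Polynomial.isUnit_iff.1 hau
  have : H = Polynomial.C (Polynomial.C b) := by
    rw [← Polynomial.Bivariate.swap_swap_apply H, ← hH', ha, Polynomial.Bivariate.swap_C_C]
  rw [this, Polynomial.natDegree_C]

variable {R : Type*} [CommRing R] [Algebra R k[X]]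

/-- The variable `X` is not a root of a monic polynomial with scalar coefficients. -/
lemma exists_coeff_natDegree_ne_zero {m : R[X]} (hm : m.Monic)
    (h : Polynomial.aeval (Polynomial.X : k[X]) m = 0) :
    ∃ i, (algebraMap R k[X] (m.coeff i)).natDegree ≠ 0 := by
  by_contra! hall
  rw [Polynomial.aeval_eq_sum_range] at h
  have h1 := congrArg (fun q : k[X] => q.coeff m.natDegree) h
  have h2 : ∀ i, m.coeff i • (Polynomial.X : k[X]) ^ i =
      Polynomial.C ((algebraMap R k[X] (m.coeff i)).coeff 0) * Polynomial.X ^ i := fun i => by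
    rw [← Polynomial.eq_C_of_natDegree_eq_zero (hall i), Algebra.smul_def]
  simp only [h2, Polynomial.finsetSum_coeff, Polynomial.coeff_C_mul_X_pow] at h1
  rw [Finset.sum_ite_eq, if_pos (by simp), Polynomial.coeff_natDegree, hm.leadingCoeff] at h1
  simp at h1

variable [Algebra k R] [IsScalarTower k R k[X]]

/-- Expansion of `q` in base `c`: `k[X]` is generated over `k[c]` by the powers of `X` below the
degree of `c`. -/
lemma exists_reduction {c : R} (hc : (algebraMap R k[X] c).natDegree ≠ 0) (q : k[X]) :
    ∃ Q : R[X], Q.natDegree < (algebraMap R k[X] c).natDegree ∧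
      (∀ i, Q.coeff i ∈ Algebra.adjoin k {c}) ∧
      Polynomial.aeval (Polynomial.X : k[X]) Q = q := by
  set C := algebraMap R k[X] c with hC
  have hC0 : C ≠ 0 := by rintro h; simp [h] at hc
  have key : ∀ (N : ℕ) (q : k[X]), q.natDegree < N → ∃ Q : R[X],
      Q.natDegree < C.natDegree ∧ (∀ i, Q.coeff i ∈ Algebra.adjoin k {c}) ∧
      Polynomial.aeval (Polynomial.X : k[X]) Q = q := by
    intro N
    induction N with
    | zero => intro q h; omega
    | succ N ih =>
      intro q hq
      rcases lt_or_ge q.natDegree C.natDegree with h | h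
      · refine ⟨q.map (algebraMap k R), Polynomial.natDegree_map_le.trans_lt h, fun i => ?_, ?_⟩
        · rw [Polynomial.coeff_map]; exact Subalgebra.algebraMap_mem _ _
        · rw [Polynomial.aeval_map_algebraMap, Polynomial.aeval_X_left_apply]
      · obtain ⟨Q, hQ1, hQ2, hQ3⟩ := ih (q / C) (by
          have hq0 : q ≠ 0 := by rintro rfl; rw [Polynomial.natDegree_zero] at h; omega
          by_cases hz : q / C = 0
          · rw [hz, Polynomial.natDegree_zero]; omega
          · have := Polynomial.natDegree_lt_natDegree hz (Polynomial.degree_div_lt hq0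
              (Polynomial.natDegree_pos_iff_degree_pos.1 (Nat.pos_of_ne_zero hc)))
            omega)
        have hlt : (q % C).natDegree < C.natDegree := Polynomial.natDegree_mod_lt q hc
        refine ⟨Polynomial.C c * Q + (q % C).map (algebraMap k R), ?_, fun i => ?_, ?_⟩
        · refine (Polynomial.natDegree_add_le _ _).trans_lt (max_lt ?_ ?_)
          · exact (Polynomial.natDegree_C_mul_le _ _).trans_lt hQ1
          · exact Polynomial.natDegree_map_le.trans_lt hlt
        · rw [Polynomial.coeff_add, Polynomial.coeff_C_mul, Polynomial.coeff_map]
          exact add_mem (mul_mem (Algebra.self_mem_adjoin_singleton k c) (hQ2 i))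
            (Subalgebra.algebraMap_mem _ _)
        · rw [map_add, map_mul, Polynomial.aeval_C, hQ3, Polynomial.aeval_map_algebraMap,
            Polynomial.aeval_X_left_apply]
          exact EuclideanDomain.div_add_mod q C
  exact key _ q (Nat.lt_succ_self _)

/-- Lüroth's theorem for integrally closed rings between `k` and `k[X]`. It is stated for an
abstract `R` embedded in `k[X]` rather than for a subalgebra. -/
theorem nonempty_equiv_of_isIntegrallyClosed [IsDomain R] [IsIntegrallyClosed R]
    (hinj : Function.Injective (algebraMap R k[X]))
    (hX : IsIntegral R (Polynomial.X : k[X])) : Nonempty (R ≃ₐ[k] k[X]) := by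
  have : FaithfulSMul R k[X] := (faithfulSMul_iff_algebraMap_injective R k[X]).2 hinj
  have : Module.IsTorsionFree R k[X] := inferInstance
  obtain ⟨i, hi⟩ := exists_coeff_natDegree_ne_zero (minpoly.monic hX) (minpoly.aeval R _)
  set m := minpoly R (Polynomial.X : k[X]) with hm
  set c := m.coeff i with hc
  set C := algebraMap R k[X] c with hC
  have hroot : Polynomial.aeval (Polynomial.X : k[X])
      (C.map (algebraMap k R) - Polynomial.C c) = 0 := by
    rw [map_sub, Polynomial.aeval_C, Polynomial.aeval_map_algebraMap, Polynomial.aeval_X_left_apply,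
      sub_self]
  have hdeg : m.natDegree = C.natDegree := by
    obtain ⟨h, hh⟩ := minpoly.isIntegrallyClosed_dvd hX hroot
    rw [← hm] at hh
    have hh' := congrArg (Polynomial.map (algebraMap R k[X])) hh
    rw [Polynomial.map_mul, Polynomial.map_sub, Polynomial.map_map, Polynomial.map_C,
      ← IsScalarTower.algebraMap_eq] at hh'
    have h0 := natDegree_eq_zero_of_mul_eq (c := C) (i := i) hh'.symm
      (by rw [Polynomial.coeff_map]) hi
    rw [Polynomial.natDegree_map_eq_of_injective hinj] at h0
    have hP : (C.map (algebraMap k R) - Polynomial.C c).natDegree = C.natDegree := by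
      rw [Polynomial.natDegree_sub_C, Polynomial.natDegree_map]
    have hne : h ≠ 0 := by
      rintro rfl
      rw [hh, mul_zero] at hP
      exact hi hP.symm
    rw [hh, Polynomial.natDegree_mul (minpoly.ne_zero hX) hne, h0, add_zero] at hP
    exact hP
  -- Let `Q` be the expansion of `y` in base `c`. Then `Q - y` has the root `X` and degree less than
  -- that of `m`, so `Q` is the constant `y`, and its coefficients lie in `k[c]`.
  have hgen : ∀ y, y ∈ Algebra.adjoin k {c} := by
    intro y
    obtain ⟨Q, hQd, hQc, hQ⟩ := exists_reduction hi (algebraMap R k[X] y)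
    have h0 : Q - Polynomial.C y = 0 := by
      by_contra hne
      have hQy : Polynomial.aeval (Polynomial.X : k[X]) (Q - Polynomial.C y) = 0 := by
        rw [map_sub, hQ, Polynomial.aeval_C, sub_self]
      have h1 := minpoly.IsIntegrallyClosed.degree_le_of_ne_zero hne hQy
      have h2 := Polynomial.natDegree_le_natDegree h1
      rw [Polynomial.natDegree_sub_C, ← hm, hdeg] at h2
      exact absurd hQd (not_lt.2 h2)
    have h1 := hQc 0
    rw [sub_eq_zero.1 h0, Polynomial.coeff_C_zero] at h1
    exact h1
  refine ⟨(AlgEquiv.ofBijective (Polynomial.aeval (R := k) c) ⟨?_, fun y => ?_⟩).symm⟩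
  · rw [injective_iff_map_eq_zero]
    intro p hp
    have h1 : p.comp C = 0 := by
      have := congrArg (IsScalarTower.toAlgHom k R k[X]) hp
      rw [← Polynomial.aeval_algHom_apply, map_zero] at this
      exact this
    rcases Polynomial.comp_eq_zero_iff.1 h1 with h | ⟨-, h⟩
    · exact h
    · rw [h, Polynomial.natDegree_C] at hi; exact absurd rfl hi
  · have h1 := hgen y
    rw [Algebra.adjoin_singleton_eq_range_aeval] at h1
    exact h1

end Luroth

/-! ### Centralizers -/

section Main
variable {k : Type*} [Field k]

/-- The image of the centralizer in `k[X]` contains every polynomial that is a quotient of two of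
its elements. -/
lemma mem_of_mul_mem {s : ℕ} {f : MonoidAlgebra k (Word s)}
    {φ : Subalgebra.centralizer k {f} →ₐ[k] k[X]} (hφ : Function.Injective φ)
    (hnc : ∃ r ∈ φ.range, r.natDegree ≠ 0) {d u : k[X]} (hd : d ∈ φ.range) (hd0 : d ≠ 0)
    (hdu : d * u ∈ φ.range) : u ∈ φ.range := by
  by_cases hu : u.natDegree = 0
  · rw [Polynomial.eq_C_of_natDegree_eq_zero hu]
    exact Subalgebra.algebraMap_mem _ _
  obtain ⟨r, hr, hrd⟩ := hnc
  obtain ⟨D, hD, hD0, hDu⟩ := exists_denominator hr hrd hd hd0 hdu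
  obtain ⟨e, he, he0, heu⟩ := exists_conductor hD hD0 hDu hu
  set ι : φ.range →ₐ[k] MonoidAlgebra k (Word s) := (Subalgebra.centralizer k {f}).val.comp
    (AlgEquiv.ofInjective φ hφ).symm.toAlgHom with hι
  have hιinj : Function.Injective ι :=
    Subtype.val_injective.comp (AlgEquiv.ofInjective φ hφ).symm.injective
  have hιφ : ∀ x : φ.range, ∃ a : Subalgebra.centralizer k {f}, φ a = x ∧ ι x = a := fun x =>
    ⟨(AlgEquiv.ofInjective φ hφ).symm x,
      congrArg Subtype.val ((AlgEquiv.ofInjective φ hφ).apply_symm_apply x), rfl⟩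
  obtain ⟨y, hy⟩ := exists_eq_mul_of_dividedDiff (j := φ.range.val) Subtype.val_injective ι hιinj u
    (fun i => ⟨D * u ^ i, hDu i⟩) (fun i => ⟨u ^ i * Polynomial.aeval u e, heu i⟩) e he
    (fun h => hD0 (by simpa using congrArg Subtype.val h))
    (fun h => he0 (by simpa using congrArg Subtype.val h))
    (fun i => by simp) (fun i => by simp)
  obtain ⟨a, ha, hιa⟩ := hιφ ⟨D * u ^ 0, hDu 0⟩
  obtain ⟨b, hb, hιb⟩ := hιφ ⟨D * u ^ 1, hDu 1⟩
  simp only [pow_zero, mul_one, pow_one] at ha hb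
  rw [hιa, hιb] at hy
  have ha0 : (a : MonoidAlgebra k (Word s)) ≠ 0 := by
    intro h
    rw [ZeroMemClass.coe_eq_zero] at h
    rw [h, map_zero] at ha
    exact hD0 ha.symm
  have hac := Subalgebra.mem_centralizer_iff k |>.1 a.2 f rfl
  have hbc := Subalgebra.mem_centralizer_iff k |>.1 b.2 f rfl
  -- The quotient `y` of `b` by `a` commutes with `f` because `a` and `b` do.
  have hyc : y ∈ Subalgebra.centralizer k {f} := by
    rw [Subalgebra.mem_centralizer_iff]
    rintro _ rfl
    apply mul_left_cancel₀ ha0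
    rw [← mul_assoc, ← hac, mul_assoc, ← hy, hbc, hy, mul_assoc]
  refine ⟨⟨y, hyc⟩, ?_⟩
  have hab : b = a * ⟨y, hyc⟩ := Subtype.ext hy
  rw [hab, map_mul, ha] at hb
  exact mul_left_cancel₀ hD0 hb

theorem nonempty_centralizer_equiv {s : ℕ} {f : MonoidAlgebra k (Word s)}
    (hf : f ∉ Set.range (algebraMap k (MonoidAlgebra k (Word s)))) :
    Nonempty (Subalgebra.centralizer k {f} ≃ₐ[k] k[X]) := by
  obtain ⟨φ, hφ⟩ := exists_injective_algHom hf
  have hnc : ∃ r ∈ φ.range, r.natDegree ≠ 0 := by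
    have hff : f ∈ Subalgebra.centralizer k {f} := by simp [Subalgebra.mem_centralizer_iff]
    refine ⟨φ ⟨f, hff⟩, ⟨_, rfl⟩, fun h => hf ⟨(φ ⟨f, hff⟩).coeff 0, ?_⟩⟩
    have h1 : algebraMap k (Subalgebra.centralizer k {f}) ((φ ⟨f, hff⟩).coeff 0) = ⟨f, hff⟩ := by
      apply hφ
      rw [AlgHom.commutes]
      exact (Polynomial.eq_C_of_natDegree_eq_zero h).symm
    exact congrArg Subtype.val h1
  have hic : IsIntegrallyClosed φ.range :=
    isIntegrallyClosed_of_forall_mem fun d u hd hd0 hdu => mem_of_mul_mem hφ hnc hd hd0 hdu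
  obtain ⟨r, hr, hrd⟩ := hnc
  obtain ⟨E⟩ := nonempty_equiv_of_isIntegrallyClosed (R := φ.range) (k := k)
    Subtype.val_injective (isIntegral_X_of_mem hr hrd)
  exact ⟨(AlgEquiv.ofInjective φ hφ).trans E⟩

theorem nonempty_centralizer_equiv_freeAlgebra {s : ℕ} {f : FreeAlgebra k (Fin s)}
    (hf : f ∉ Set.range (algebraMap k (FreeAlgebra k (Fin s)))) :
    Nonempty (Subalgebra.centralizer k {f} ≃ₐ[k] k[X]) := by
  let E := FreeAlgebra.equivMonoidAlgebraFreeMonoid (R := k) (X := Fin s)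
  have hEf : E f ∉ Set.range (algebraMap k (MonoidAlgebra k (Word s))) := by
    rintro ⟨c, hc⟩
    exact hf ⟨c, E.injective (by rw [← hc, AlgEquiv.commutes])⟩
  obtain ⟨F⟩ := nonempty_centralizer_equiv hEf
  have hmap : (Subalgebra.centralizer k {f}).map E.toAlgHom = Subalgebra.centralizer k {E f} := by
    ext y
    obtain ⟨x, rfl⟩ := E.surjective y
    have h1 : E x ∈ (Subalgebra.centralizer k {f}).map E.toAlgHom ↔
        x ∈ Subalgebra.centralizer k {f} :=
      ⟨fun ⟨z, hz, hzx⟩ => E.injective hzx ▸ hz, fun h => ⟨x, h, rfl⟩⟩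
    rw [h1]
    simp only [Subalgebra.mem_centralizer_iff, Set.mem_singleton_iff, forall_eq]
    rw [← map_mul, ← map_mul, E.injective.eq_iff]
  exact ⟨((E.subalgebraMap (Subalgebra.centralizer k {f})).trans
    (Subalgebra.equivOfEq _ _ hmap)).trans F⟩

lemma ι_notMem_range_algebraMap {X : Type*} (x : X) :
    FreeAlgebra.ι k x ∉ Set.range (algebraMap k (FreeAlgebra k X)) := by
  rintro ⟨c, hc⟩
  exact FreeAlgebra.ι_ne_algebraMap x c hc.symm

lemma exists_mem_notMem_range_of_maximal {A : Type*} [Ring A] [Algebra k A] {C : Subalgebra k A}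
    (hC : Maximal (fun D : Subalgebra k A => ∀ a ∈ D, ∀ b ∈ D, a * b = b * a) C)
    {x : A} (hx : x ∉ Set.range (algebraMap k A)) :
    ∃ f ∈ C, f ∉ Set.range (algebraMap k A) := by
  by_contra! hall
  have hle : C ≤ Algebra.adjoin k {x} := fun a ha => by
    obtain ⟨c, rfl⟩ := hall a ha
    exact Subalgebra.algebraMap_mem _ _
  have hcomm : ∀ a ∈ Algebra.adjoin k {x}, ∀ b ∈ Algebra.adjoin k {x}, a * b = b * a := by
    intro a ha b hb
    rw [Algebra.adjoin_singleton_eq_range_aeval] at ha hb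
    obtain ⟨p, rfl⟩ := ha
    obtain ⟨q, rfl⟩ := hb
    
    rw [← map_mul, ← map_mul, mul_comm]
  exact hx (hall x (hC.2 hcomm hle (Algebra.self_mem_adjoin_singleton k x)))

end Main

end BergmanCentralizer

theorem theorem1p3 {k : Type*} [Field k] (p : ℕ) [Fact p.Prime] [CharP k p]
    (s : ℕ) (hs : 1 ≤ s) :
    (∀ f : FreeAlgebra k (Fin s), f ∉ Set.range (algebraMap k (FreeAlgebra k (Fin s))) →
      Nonempty (Subalgebra.centralizer k ({f} : Set (FreeAlgebra k (Fin s))) ≃ₐ[k] k[X])) ∧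
    (∀ C : Subalgebra k (FreeAlgebra k (Fin s)),
      Maximal (fun D : Subalgebra k (FreeAlgebra k (Fin s)) =>
        ∀ a ∈ D, ∀ b ∈ D, a * b = b * a) C →
      Nonempty (C ≃ₐ[k] k[X])) := by
  refine ⟨fun f hf => BergmanCentralizer.nonempty_centralizer_equiv_freeAlgebra hf,
    fun C hC => ?_⟩
  obtain ⟨f, hfC, hf⟩ := BergmanCentralizer.exists_mem_notMem_range_of_maximal hC
    (BergmanCentralizer.ι_notMem_range_algebraMap (k := k) (⟨0, hs⟩ : Fin s))
  obtain ⟨E⟩ := BergmanCentralizer.nonempty_centralizer_equiv_freeAlgebra hf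
  have hle : C ≤ Subalgebra.centralizer k {f} := fun a ha => by
    rw [Subalgebra.mem_centralizer_iff]
    rintro _ rfl
    exact hC.1 _ hfC _ ha
  have hcomm : ∀ a ∈ Subalgebra.centralizer k {f}, ∀ b ∈ Subalgebra.centralizer k {f},
      a * b = b * a := fun a ha b hb =>
    congrArg Subtype.val (E.injective (a₁ := ⟨a, ha⟩ * ⟨b, hb⟩) (a₂ := ⟨b, hb⟩ * ⟨a, ha⟩)
      (by rw [map_mul, map_mul, mul_comm]))
  rw [le_antisymm hle (hC.2 hcomm hle)]
  exact ⟨E⟩
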